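/- For an entire function $f$ and $n\ge 1$ write $f^{\underline n}(z)=f(z)f(z-1)\cdots f(z-n+1)$; in particular $(z-z_0)^{\underline n}=(z-z_0)(z-z_0-1)\cdots(z-z_0-n+1)$. Let $\Delta f(z)=f(z+1)-f(z)$. A point $z_0$ is a zero of $f$ with length $m\ge1$ if $\Delta^k f(z_0)=0$ for $0\le k<m$ and $\Delta^m f(z_0)\ne0$. Let $f,g$ be entire functions. The polynomial $z-z_0$ is a common shifting divisor of $f$ and $g$ if there are a zero $z_1$ of $f$ with some length $m$, a zero $z_2$ of $g$ with some length $l$, integers $1\le m_1\le m$, $1\le l_1\le l$ and entire functions $F,G$ with $$f(z)=(z-z_1)^{\underline{m_1}}F(z),\qquad g(z)=(z-z_2)^{\underline{l_1}}G(z),\qquad f(z)g(z)=(z-z_0)^{\underline{m_1+l_1}}F(z)G(z),$$ where $z_0\in\{z_1,z_2\}$. Two entire functions are relatively shifting prime if they have no common shifting divisor of the form $z-z_0$, $z_0\in\mathbb C$; three entire functions are relatively shifting prime if every two of them are. The order of an entire function $f$ is $\rho(f)=\limsup_{r\to\infty}\frac{\log^+\log^+ M(r,f)}{\log r}$, where $M(r,f)=\max_{|z|=r}|f(z)|$.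 **Theorem.** Let $a$, $b$ and $c$ be entire functions of order less than $1$, not all of them constant, and let $n\ge1$ be an integer such that $a^{\underline n}$, $b^{\underline n}$ and $c^{\underline n}$ are relatively shifting prime and satisfy $$a^{\underline n}+b^{\underline n}=c^{\underline n}.$$ Then $n\le 2$. In addition, if at least one of $a$, $b$ and $c$ is a constant, then $n=1$. -/

import Mathlib

noncomputable section

namespace ShiftFermat

/-- The falling power `f(z) f(z-1) ⋯ f(z-n+1)` of a function `f`. In particular
`fallingPow (fun z => z - z₀) m` is the falling factorial of `z - z₀` of length `m`. -/
def fallingPow (f : ℂ → ℂ) (n : ℕ) : ℂ → ℂ :=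
  fun z => ∏ j ∈ Finset.range n, f (z - (j : ℂ))

/-- An entire function. -/
def IsEntire (f : ℂ → ℂ) : Prop := Differentiable ℂ f

/-- A constant function. -/
def IsConstant (f : ℂ → ℂ) : Prop := ∃ k : ℂ, ∀ z : ℂ, f z = k

/-- The maximum modulus `M(r, f)` on the circle `|z| = r`. -/
def maxModulus (f : ℂ → ℂ) (r : ℝ) : ℝ :=
  sSup ((fun z : ℂ => ‖f z‖) '' Metric.sphere (0 : ℂ) r)

/-- The order of growth `limsup_{r → ∞} log⁺ log⁺ M(r, f) / log r` of an entire function, as an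
extended real number. -/
def growthOrder (f : ℂ → ℂ) : EReal :=
  Filter.limsup
    (fun r : ℝ => ((Real.posLog (Real.posLog (maxModulus f r)) / Real.log r : ℝ) : EReal))
    Filter.atTop

/-- `z₀` is a zero of `f` with length `m`: the differences `Δ^k f` vanish at `z₀` for `0 ≤ k < m`,
`Δ^m f` does not, where `Δ f (z) = f (z + 1) - f z`; since `z₀` is a zero, `1 ≤ m`. -/
def IsZeroOfLength (f : ℂ → ℂ) (z₀ : ℂ) (m : ℕ) : Prop :=
  1 ≤ m ∧ (∀ k < m, (fwdDiff (1 : ℂ))^[k] f z₀ = 0) ∧ (fwdDiff (1 : ℂ))^[m] f z₀ ≠ 0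

/-- `z - z₀` is a common shifting divisor of the entire functions `f` and `g`. -/
def IsCommonShiftingDivisor (f g : ℂ → ℂ) (z₀ : ℂ) : Prop :=
  ∃ (z₁ z₂ : ℂ) (m n : ℕ), IsZeroOfLength f z₁ m ∧ IsZeroOfLength g z₂ n ∧
    ∃ (m₁ n₁ : ℕ), 1 ≤ m₁ ∧ m₁ ≤ m ∧ 1 ≤ n₁ ∧ n₁ ≤ n ∧
      ∃ (F G : ℂ → ℂ), IsEntire F ∧ IsEntire G ∧
        (∀ z, f z = fallingPow (fun w => w - z₁) m₁ z * F z) ∧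
        (∀ z, g z = fallingPow (fun w => w - z₂) n₁ z * G z) ∧
        (z₀ = z₁ ∨ z₀ = z₂) ∧
        ∀ z, f z * g z = fallingPow (fun w => w - z₀) (m₁ + n₁) z * (F z * G z)

/-- `f` and `g` have no nonconstant common shifting divisor. -/
def RelativelyShiftingPrime (f g : ℂ → ℂ) : Prop :=
  ∀ z₀ : ℂ, ¬ IsCommonShiftingDivisor f g z₀

/-- Three functions are relatively shifting prime: no two of them have a nonconstant common
shifting divisor. -/
def RelativelyShiftingPrime₃ (f g h : ℂ → ℂ) : Prop :=
  RelativelyShiftingPrime f g ∧ RelativelyShiftingPrime f h ∧ RelativelyShiftingPrime g h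

end ShiftFermat

end

/-! The proof is a difference analogue of the Wronskian proof of Fermat's theorem for polynomials.
Put n = m + 1 and write A, B, C for the falling powers of length m. Eliminating between the equation
at z and at z + 1 gives B w_ab = C w_ac and A w_ab = C w_cb, where w is `casorati`
(`fallingPow_mul_casorati`). For n ≥ 2, zeros of a falling power come in runs, so shifting primality
forbids common zeros (`RelativelyShiftingPrime.ne_zero_of_eq_zero`). Hence w_ab = C V with V entire,
and then w_ac = B V and w_cb = A V.

Order less than one makes f(z + η) = (1 + o(1)) f(z), for bounded η, on circles of arbitrarily large
radius (`exists_good_circle`). There w_xy = o(|x||y|), so multiplying the three relations gives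
|V|^3 |abc|^(m-2) = o(1). If m ≥ 2 the maximum principle forces V = 0; if m = 1 and one function is
constant, two of the relations already give V^2 = o(1) (`casorati_eq_zero`).

So the ratios of the falling powers are 1-periodic. A zero would then propagate along u, u + 1, ...,
which small order excludes; zero-free functions of order less than one are constant, so a, b, c all
are (`isConstant_of_proportional`). -/

open Metric MeasureTheory Filter Topology

namespace ShiftFermat

/-! ### Choosing a radius by averaging -/

section Radius

theorem integral_abs_sub_rpow_right {σ : ℝ} (h1 : σ < 1) (t c : ℝ) (hc : 0 ≤ c) :
    IntervalIntegrable (fun r => |r - t| ^ (-σ)) volume t (t + c) ∧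
      ∫ r in t..(t + c), |r - t| ^ (-σ) = c ^ (1 - σ) / (1 - σ) := by
  have hcongr : ∀ r ∈ Set.uIcc t (t + c), (r - t) ^ (-σ) = |r - t| ^ (-σ) := by
    intro r hr
    rw [Set.uIcc_of_le (by linarith)] at hr
    rw [abs_of_nonneg (by linarith [hr.1])]
  constructor
  · have h := (intervalIntegral.intervalIntegrable_rpow' (a := 0) (b := c)
      (show -1 < -σ by linarith)).comp_sub_right t
    rw [zero_add, add_comm c t] at h
    exact h.congr_uIoo fun r hr => hcongr r (Set.Ioo_subset_Icc_self hr)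
  · rw [← intervalIntegral.integral_congr hcongr,
      intervalIntegral.integral_comp_sub_right (fun x => x ^ (-σ)),
      integral_rpow (Or.inl (by linarith))]
    rw [sub_self, add_sub_cancel_left, neg_add_eq_sub, Real.zero_rpow (by linarith), sub_zero]

theorem integral_abs_sub_rpow_left {σ : ℝ} (h1 : σ < 1) (t c : ℝ) (hc : 0 ≤ c) :
    IntervalIntegrable (fun r => |r - t| ^ (-σ)) volume (t - c) t ∧
      ∫ r in (t - c)..t, |r - t| ^ (-σ) = c ^ (1 - σ) / (1 - σ) := by
  obtain ⟨h, h'⟩ := integral_abs_sub_rpow_right h1 t c hc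
  have hcongr : (fun r => |(2 * t - r) - t| ^ (-σ)) = fun r => |r - t| ^ (-σ) := by
    funext r
    rw [← abs_neg]
    ring_nf
  constructor
  · have := h.comp_sub_left (2 * t)
    rw [hcongr] at this
    convert this.symm using 1 <;> ring
  · rw [← hcongr, intervalIntegral.integral_comp_sub_left (fun x => |x - t| ^ (-σ)), ← h']
    congr 1 <;> ring

/-- Exponents below 1 keep the singularity at t integrable; the exponent 1 needed later is recovered
from them in `exists_good_circle_zero`. -/
theorem integral_abs_sub_rpow_le {σ R t : ℝ} (h1 : σ < 1) (ht : t ∈ Set.Icc R (2 * R)) :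
    IntervalIntegrable (fun r => |r - t| ^ (-σ)) volume R (2 * R) ∧
      ∫ r in R..(2 * R), |r - t| ^ (-σ) ≤ 2 / (1 - σ) * R ^ (1 - σ) := by
  obtain ⟨i1, e1⟩ := integral_abs_sub_rpow_left h1 t (t - R) (by linarith [ht.1])
  obtain ⟨i2, e2⟩ := integral_abs_sub_rpow_right h1 t (2 * R - t) (by linarith [ht.2])
  rw [sub_sub_cancel] at i1 e1
  rw [add_sub_cancel] at i2 e2
  refine ⟨i1.trans i2, ?_⟩
  rw [← intervalIntegral.integral_add_adjacent_intervals i1 i2, e1, e2]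
  have hσ : 0 < 1 - σ := by linarith
  have a1 : (t - R) ^ (1 - σ) ≤ R ^ (1 - σ) :=
    Real.rpow_le_rpow (by linarith [ht.1]) (by linarith [ht.2]) hσ.le
  have a2 : (2 * R - t) ^ (1 - σ) ≤ R ^ (1 - σ) :=
    Real.rpow_le_rpow (by linarith [ht.2]) (by linarith [ht.1]) hσ.le
  rw [← add_div, div_mul_eq_mul_div]
  gcongr
  linarith

theorem integral_sum_abs_sub_rpow_le {σ R : ℝ} (h1 : σ < 1) (T : Multiset ℝ)
    (hT : ∀ t ∈ T, t ∈ Set.Icc R (2 * R)) :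
    IntervalIntegrable (fun r => (T.map fun t => |r - t| ^ (-σ)).sum) volume R (2 * R) ∧
      ∫ r in R..(2 * R), (T.map fun t => |r - t| ^ (-σ)).sum
        ≤ T.card * (2 / (1 - σ) * R ^ (1 - σ)) := by
  induction T using Multiset.induction with
  | empty => simp
  | cons t T ih =>
    obtain ⟨i1, e1⟩ := integral_abs_sub_rpow_le h1 (hT t (by simp))
    obtain ⟨i2, e2⟩ := ih fun s hs => hT s (by simp [hs])
    simp only [Multiset.map_cons, Multiset.sum_cons, Multiset.card_cons]
    refine ⟨i1.add i2, ?_⟩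
    rw [intervalIntegral.integral_add i1 i2]
    push_cast
    linarith

theorem exists_radius_of_mem_Icc {σ R : ℝ} (h1 : σ < 1) (hR : 0 < R) (T : Multiset ℝ)
    (hT : ∀ t ∈ T, t ∈ Set.Icc R (2 * R)) :
    ∃ r ∈ Set.Icc R (2 * R), r ∉ T ∧
      (T.map fun t => |r - t| ^ (-σ)).sum ≤ T.card * (2 / (1 - σ) * R ^ (-σ)) := by
  classical
  obtain ⟨hi, he⟩ := integral_sum_abs_sub_rpow_le h1 T hT
  have hRR : R ≤ 2 * R := by linarith
  rw [intervalIntegral.integral_of_le hRR] at he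
  rw [intervalIntegrable_iff_integrableOn_Ioc_of_le hRR] at hi
  have hvol : volume (Set.Ioc R (2 * R)) = ENNReal.ofReal R := by
    rw [Real.volume_Ioc]; congr 1; ring
  have hμ : volume.restrict (Set.Ioc R (2 * R)) ≠ 0 := by
    rw [Ne, Measure.restrict_eq_zero, hvol]
    simpa using hR
  -- Points of T must be avoided explicitly: for σ ≠ 0, `0 ^ (-σ) = 0` in Lean, so a small sum alone
  -- would not exclude r ∈ T.
  have hN : volume.restrict (Set.Ioc R (2 * R))
      ((Set.Ioc R (2 * R))ᶜ ∪ (T.toFinset : Set ℝ)) = 0 := by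
    rw [measure_union_null_iff]
    refine ⟨by rw [Measure.restrict_apply measurableSet_Ioc.compl]; simp, ?_⟩
    exact Measure.restrict_le_self.absolutelyContinuous (Finset.measure_zero _ _)
  obtain ⟨r, hr, hle⟩ := exists_notMem_null_le_average hμ hi hN
  simp only [Set.mem_union, Set.mem_compl_iff, not_or, not_not, Finset.mem_coe,
    Multiset.mem_toFinset] at hr
  refine ⟨r, Set.Ioc_subset_Icc_self hr.1, hr.2, hle.trans ?_⟩
  rw [setAverage_eq, Measure.real, hvol, ENNReal.toReal_ofReal hR.le, smul_eq_mul]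
  calc R⁻¹ * _ ≤ R⁻¹ * (T.card * (2 / (1 - σ) * R ^ (1 - σ))) := by gcongr
    _ = _ := by
      rw [sub_eq_neg_add, Real.rpow_add hR, Real.rpow_one]
      field_simp

/-- Some radius in `[R, 2R]` stays away, on average, from a given finite family of reals. -/
theorem exists_radius {σ R : ℝ} (h0 : 0 < σ) (h1 : σ < 1) (hR : 0 < R) (T : Multiset ℝ) :
    ∃ r ∈ Set.Icc R (2 * R), r ∉ T ∧
      (T.map fun t => |r - t| ^ (-σ)).sum ≤ T.card * (2 / (1 - σ) * R ^ (-σ)) := by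
  have hRR : R ≤ 2 * R := by linarith
  -- Clamping t to [R, 2R] only brings it closer to r, hence only increases the sum.
  obtain ⟨r, hr, hrT, hle⟩ := exists_radius_of_mem_Icc h1 hR
    (T.map fun t => max R (min (2 * R) t)) (by
      intro t ht
      obtain ⟨s, -, rfl⟩ := Multiset.mem_map.1 ht
      exact ⟨le_max_left _ _, max_le hRR (min_le_left _ _)⟩)
  have hmem : ∀ t ∈ T, r ≠ max R (min (2 * R) t) := fun t ht h =>
    hrT (Multiset.mem_map.2 ⟨t, ht, h.symm⟩)
  refine ⟨r, hr, fun h => hmem r h ?_, le_trans ?_ (hle.trans (by rw [Multiset.card_map]))⟩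
  · rw [min_eq_right hr.2, max_eq_right hr.1]
  · rw [Multiset.map_map]
    refine Multiset.sum_map_le_sum_map _ _ fun t ht => ?_
    refine Real.rpow_le_rpow_of_nonpos (abs_pos.2 (sub_ne_zero.2 (hmem t ht))) ?_ (by linarith)
    obtain ⟨hr1, hr2⟩ := hr
    beta_reduce
    rcases le_total t R with h | h
    · rw [min_eq_right (by linarith), max_eq_left h, abs_of_nonneg (by linarith),
        abs_of_nonneg (by linarith)]
      linarith
    rcases le_total t (2 * R) with h' | h'
    · rw [min_eq_right h', max_eq_right h]
    · rw [min_eq_left h', max_eq_right hRR, abs_of_nonpos (by linarith),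
        abs_of_nonpos (by linarith)]
      linarith

end Radius

/-! ### Splitting off zeros, and the logarithm of the zero-free part -/

section Factorization

theorem norm_multiset_prod_one_add_sub_one_le (S : Multiset ℂ) :
    ‖(S.map fun x => 1 + x).prod - 1‖ ≤ Real.exp (S.map fun x => ‖x‖).sum - 1 := by
  induction S using Multiset.induction with
  | empty => simp
  | cons x S ih =>
    simp only [Multiset.map_cons, Multiset.prod_cons, Multiset.sum_cons, Real.exp_add]
    set P := (S.map fun x => 1 + x).prod
    set E := Real.exp (S.map fun x => ‖x‖).sum
    have hE : 0 < E := Real.exp_pos _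
    have hx : 1 + ‖x‖ ≤ Real.exp ‖x‖ := by linarith [Real.add_one_le_exp ‖x‖]
    calc ‖(1 + x) * P - 1‖ = ‖(1 + x) * (P - 1) + x‖ := by ring_nf
      _ ≤ ‖(1 + x) * (P - 1)‖ + ‖x‖ := norm_add_le _ _
      _ ≤ (1 + ‖x‖) * (E - 1) + ‖x‖ := by
        rw [norm_mul]
        gcongr
        exact (norm_add_le _ _).trans (by simp)
      _ ≤ Real.exp ‖x‖ * E - 1 := by nlinarith

theorem norm_le_of_sphere {f : ℂ → ℂ} (hf : Differentiable ℂ f) {p : ℂ} {r C : ℝ} (hr : 0 < r)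
    (h : ∀ z ∈ sphere p r, ‖f z‖ ≤ C) {z : ℂ} (hz : z ∈ closedBall p r) : ‖f z‖ ≤ C := by
  refine Complex.norm_le_of_forall_mem_frontier_norm_le (U := ball p r) isBounded_ball
    hf.diffContOnCl ?_ ?_
  · rwa [frontier_ball p hr.ne']
  · rwa [closure_ball p hr.ne']

theorem exists_eq_sub_mul {f : ℂ → ℂ} (hf : Differentiable ℂ f) {s : ℂ} (hs : f s = 0) :
    ∃ g : ℂ → ℂ, Differentiable ℂ g ∧ ∀ z, f z = (z - s) * g z := by
  refine ⟨dslope f s, ?_, fun z => ?_⟩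
  · rw [← differentiableOn_univ] at hf ⊢
    exact (Complex.differentiableOn_dslope Filter.univ_mem).2 hf
  · have := sub_smul_dslope f s z
    rw [hs, sub_zero, smul_eq_mul] at this
    exact this.symm

/-- On the tripled circle |z / s| ≥ 3, so each factor has modulus at least 2; this counts zeros
without Jensen's formula. -/
theorem two_pow_card_le_norm_prod {r : ℝ} (S : Multiset ℂ) (hS : ∀ s ∈ S, s ≠ 0 ∧ ‖s‖ ≤ r)
    {z : ℂ} (hz : ‖z‖ = 3 * r) : (2 : ℝ) ^ S.card ≤ ‖(S.map fun s => 1 - z / s).prod‖ := by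
  induction S using Multiset.induction with
  | empty => simp
  | cons s S ih =>
    have ih := ih fun t ht => hS t (by simp [ht])
    obtain ⟨hs0, hs⟩ := hS s (by simp)
    have hs0' : 0 < ‖s‖ := norm_pos_iff.2 hs0
    simp only [Multiset.map_cons, Multiset.prod_cons, Multiset.card_cons, pow_succ', norm_mul]
    gcongr
    have h3 : 3 ≤ ‖z / s‖ := by
      rw [norm_div, hz, le_div_iff₀ hs0']
      linarith
    have := norm_sub_norm_le (z / s) 1
    rw [norm_one, norm_sub_rev] at this
    linarith

/-- An entire function is, up to finitely many factors, free of zeros in a given disc; the number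
of factors is controlled by the size of the function on a circle of thrice the radius. -/
theorem exists_factorization {f : ℂ → ℂ} (hf : Differentiable ℂ f) (h0 : f 0 ≠ 0) {r M : ℝ}
    (hr : 0 < r) (hM : ∀ z, ‖z‖ = 3 * r → ‖f z‖ ≤ M) :
    ∃ (S : Multiset ℂ) (g : ℂ → ℂ), Differentiable ℂ g ∧ (∀ s ∈ S, s ≠ 0 ∧ ‖s‖ ≤ r) ∧
      (∀ z, f z = (S.map fun s => 1 - z / s).prod * g z) ∧ (∀ z, ‖z‖ ≤ r → g z ≠ 0) ∧
      (2 : ℝ) ^ S.card * ‖f 0‖ ≤ M ∧ ∀ z, ‖z‖ ≤ 3 * r → ‖g z‖ ≤ M := by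
  have key : ∀ (S : Multiset ℂ) (g : ℂ → ℂ), Differentiable ℂ g → (∀ s ∈ S, s ≠ 0 ∧ ‖s‖ ≤ r) →
      (∀ z, f z = (S.map fun s => 1 - z / s).prod * g z) →
      ∀ z, ‖z‖ ≤ 3 * r → 2 ^ S.card * ‖g z‖ ≤ M := by
    intro S g hg hS hfg z hz
    have hpow : (0 : ℝ) < 2 ^ S.card := by positivity
    rw [mul_comm, ← le_div_iff₀ hpow]
    refine norm_le_of_sphere hg (p := 0) (r := 3 * r) (by linarith) (fun w hw => ?_) (by simpa)
    rw [mem_sphere_zero_iff_norm] at hw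
    rw [le_div_iff₀ hpow, mul_comm]
    calc 2 ^ S.card * ‖g w‖ ≤ ‖(S.map fun s => 1 - w / s).prod‖ * ‖g w‖ := by
          gcongr
          exact two_pow_card_le_norm_prod S hS hw
      _ = ‖f w‖ := by rw [hfg, norm_mul]
      _ ≤ M := hM w hw
  have hzero : ∀ (S : Multiset ℂ) (g : ℂ → ℂ),
      (∀ z, f z = (S.map fun s => 1 - z / s).prod * g z) → g 0 = f 0 := by
    intro S g h
    simp [h 0]
  have hMpos : 0 ≤ M := (norm_nonneg _).trans (hM ((3 * r : ℝ) : ℂ) (by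
    rw [Complex.norm_real, Real.norm_of_nonneg (by linarith)]))
  -- Otherwise every partial factorization leaves a zero in the disc and extraction never stops,
  -- while `key` at 0 bounds 2^k |f 0| by M for every k.
  by_contra hcon
  have hall : ∀ k : ℕ, ∃ (S : Multiset ℂ) (g : ℂ → ℂ), S.card = k ∧ Differentiable ℂ g ∧
      (∀ s ∈ S, s ≠ 0 ∧ ‖s‖ ≤ r) ∧ ∀ z, f z = (S.map fun s => 1 - z / s).prod * g z := by
    intro k
    induction k with
    | zero => exact ⟨0, f, by simp, hf, by simp, by simp⟩
    | succ k ih =>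
      obtain ⟨S, g, hk, hg, hS, hfg⟩ := ih
      have hb := key S g hg hS hfg
      have hex : ∃ s, ‖s‖ ≤ r ∧ g s = 0 := by
        by_contra! hne
        refine hcon ⟨S, g, hg, hS, hfg, hne, ?_, fun z hz => ?_⟩
        · rw [← hzero S g hfg]
          exact hb 0 (by simpa using hr.le)
        · exact le_trans (le_mul_of_one_le_left (norm_nonneg _) (one_le_pow₀ one_le_two)) (hb z hz)
      obtain ⟨s, hs, hgs⟩ := hex
      have hs0 : s ≠ 0 := by
        rintro rfl
        exact h0 (by rw [← hzero S g hfg, hgs])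
      obtain ⟨q, hq, hgq⟩ := exists_eq_sub_mul hg hgs
      refine ⟨s ::ₘ S, fun z => -s * q z, by simp [hk], hq.const_mul _, ?_, fun z => ?_⟩
      · simpa using ⟨⟨hs0, hs⟩, hS⟩
      · rw [hfg, hgq, Multiset.map_cons, Multiset.prod_cons]
        field_simp
        ring
  obtain ⟨k, hk⟩ := pow_unbounded_of_one_lt (M / ‖f 0‖) (one_lt_two (α := ℝ))
  obtain ⟨S, g, rfl, hg, hS, hfg⟩ := hall k
  have := key S g hg hS hfg 0 (by simpa using hr.le)
  rw [hzero S g hfg] at this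
  rw [div_lt_iff₀ (norm_pos_iff.2 h0)] at hk
  linarith

theorem exists_log_on_ball {g : ℂ → ℂ} (hg : Differentiable ℂ g) {r : ℝ} (hr : 0 < r)
    (hne : ∀ z, ‖z‖ ≤ r → g z ≠ 0) :
    ∃ H : ℂ → ℂ, DifferentiableOn ℂ H (ball 0 r) ∧ H 0 = 0 ∧
      ∀ z ∈ ball (0 : ℂ) r, g z = g 0 * Complex.exp (H z) := by
  have hne' : ∀ z ∈ ball (0 : ℂ) r, g z ≠ 0 := fun z hz => hne z (mem_ball_zero_iff.1 hz).le
  have hd : Differentiable ℂ (deriv g) := hg.contDiff.differentiable_deriv_two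
  have hL : DifferentiableOn ℂ (fun z => deriv g z / g z) (ball 0 r) :=
    hd.differentiableOn.div hg.differentiableOn hne'
  obtain ⟨H, hH0, hH⟩ := hL.isExactOn_ball.with_val_at 0 0
  have hHd : DifferentiableOn ℂ H (ball 0 r) := fun z hz =>
    (hH z hz).differentiableAt.differentiableWithinAt
  refine ⟨H, hHd, hH0, fun z hz => ?_⟩
  have hder : ∀ w ∈ ball (0 : ℂ) r, HasDerivAt (fun w => g w * Complex.exp (-H w)) 0 w := by
    intro w hw
    have h1 := (hg w).hasDerivAt.mul ((hH w hw).neg.cexp)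
    have := div_mul_cancel₀ (deriv g w) (hne' w hw)
    refine h1.congr_deriv ?_
    linear_combination (-1) * Complex.exp (-H w) * this
  have hconst := isOpen_ball.is_const_of_deriv_eq_zero (convex_ball (0 : ℂ) r).isPreconnected
    (fun w hw => (hder w hw).differentiableAt.differentiableWithinAt)
    (fun w hw => (hder w hw).deriv) hz (mem_ball_self hr)
  simp only [hH0, neg_zero, Complex.exp_zero, mul_one] at hconst
  rw [← hconst, mul_assoc, ← Complex.exp_add]
  simp

/-- A zero-free function which is not too large varies slowly. -/
theorem exists_exp_shift {g : ℂ → ℂ} (hg : Differentiable ℂ g) {R M : ℝ} (hR : 0 < R)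
    (hne : ∀ z, ‖z‖ ≤ 4 * R → g z ≠ 0) (hM : ∀ z, ‖z‖ ≤ 4 * R → ‖g z‖ ≤ M) {z η : ℂ}
    (hz : ‖z‖ ≤ 2 * R) (hη : ‖η‖ < R) :
    ∃ δ : ℂ, g (z + η) = g z * Complex.exp δ ∧
      ‖δ‖ ≤ 12 * (Real.log (M / ‖g 0‖) + 1) / R * ‖η‖ := by
  obtain ⟨H, hHd, hH0, hH⟩ := exists_log_on_ball hg (by linarith : 0 < 4 * R) hne
  have hg0 : 0 < ‖g 0‖ := norm_pos_iff.2 (hne 0 (by simpa using hR.le))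
  have hM0 : ‖g 0‖ ≤ M := hM 0 (by simpa using hR.le)
  -- The added 1 makes L strictly positive, as Borel–Carathéodory requires.
  set L := Real.log (M / ‖g 0‖) + 1 with hL
  have hLpos : 0 < L := by
    have := Real.log_nonneg ((one_le_div hg0).2 hM0)
    linarith
  have hre : Set.MapsTo H (ball 0 (4 * R)) {w | w.re ≤ L} := by
    intro w hw
    have h1 := hM w (mem_ball_zero_iff.1 hw).le
    rw [hH w hw, norm_mul, Complex.norm_exp] at h1
    have h2 : Real.exp (H w).re ≤ M / ‖g 0‖ := by
      rw [le_div_iff₀ hg0]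
      linarith
    have h3 := (Real.le_log_iff_exp_le (by linarith [Real.exp_pos (H w).re])).2 h2
    show (H w).re ≤ L
    linarith
  -- Borel–Carathéodory between radii 3R and 4R: 2L · 3R / (4R - 3R) = 6L. The Schwarz lemma on
  -- `ball z R` then gives the Lipschitz constant 12L / R.
  have hbd : ∀ w, ‖w‖ < 3 * R → ‖H w‖ ≤ 6 * L := by
    intro w hw
    refine (Complex.borelCaratheodory_zero hLpos hHd hre (by linarith)
      (by rw [mem_ball_zero_iff]; linarith) hH0).trans ?_
    rw [div_le_iff₀ (by linarith)]
    nlinarith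
  have hsub : ∀ w ∈ ball z R, ‖w‖ < 3 * R := by
    intro w hw
    have := norm_sub_norm_le w z
    rw [mem_ball, dist_eq_norm] at hw
    linarith
  have hin : ∀ w, ‖w‖ < 3 * R → w ∈ ball (0 : ℂ) (4 * R) := by
    intro w hw
    rw [mem_ball_zero_iff]
    linarith
  have hmem : z + η ∈ ball z R := by simpa using hη
  have hz3 : ‖z‖ < 3 * R := by linarith
  refine ⟨H (z + η) - H z, ?_, ?_⟩
  · rw [hH _ (hin _ (hsub _ hmem)), hH z (hin _ hz3), mul_assoc, ← Complex.exp_add]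
    ring_nf
  · have := Complex.dist_le_div_mul_dist_of_mapsTo_ball (f := H) (c := z) (R₁ := R) (R₂ := 12 * L)
      (hHd.mono fun w hw => hin w (hsub w hw)) (fun w hw => ?_) hmem
    · rw [dist_eq_norm, dist_eq_norm, add_sub_cancel_left] at this
      exact this
    · rw [mem_closedBall, dist_eq_norm]
      have h1 := hbd w (hsub w hw)
      have h2 := hbd z hz3
      linarith [norm_sub_le (H w) (H z)]

end Factorization

/-! ### Circles on which bounded shifts are nearly trivial -/

section GoodCircles

theorem norm_exp_sub_one_le_exp_norm (δ : ℂ) : ‖Complex.exp δ - 1‖ ≤ Real.exp ‖δ‖ - 1 := by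
  simpa using Complex.norm_exp_sub_sum_le_exp_norm_sub_sum δ 1

theorem norm_mul_sub_one_le {x y : ℂ} {a b : ℝ} (hx : ‖x - 1‖ ≤ a - 1) (hy : ‖y - 1‖ ≤ b - 1) :
    ‖x * y - 1‖ ≤ a * b - 1 := by
  have h0 := norm_nonneg (x - 1)
  have h1 := norm_nonneg (y - 1)
  calc ‖x * y - 1‖ = ‖(x - 1) * (y - 1) + (x - 1) + (y - 1)‖ := by ring_nf
    _ ≤ ‖x - 1‖ * ‖y - 1‖ + ‖x - 1‖ + ‖y - 1‖ := by
      rw [← norm_mul]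
      exact norm_add₃_le
    _ ≤ (a - 1) * (b - 1) + (a - 1) + (b - 1) := by gcongr; linarith
    _ = _ := by ring

theorem multiset_prod_shift (S : Multiset ℂ) {z η : ℂ} (hS : ∀ s ∈ S, s ≠ 0 ∧ z ≠ s) :
    (S.map fun s => 1 - (z + η) / s).prod =
      (S.map fun s => 1 + η / (z - s)).prod * (S.map fun s => 1 - z / s).prod := by
  rw [← Multiset.prod_map_mul]
  congr 1
  refine Multiset.map_congr rfl fun s hs => ?_
  have h1 := (hS s hs).1
  have h2 := sub_ne_zero.2 (hS s hs).2
  field_simp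
  ring

/-- Pointwise estimate for shifts of an entire function in terms of the distances to its zeros. -/
theorem exists_shift_estimate {f : ℂ → ℂ} (hf : Differentiable ℂ f) (h0 : f 0 ≠ 0) {R M : ℝ}
    (hR : 0 < R) (hM : ∀ z, ‖z‖ = 12 * R → ‖f z‖ ≤ M) :
    ∃ S : Multiset ℂ, (2 : ℝ) ^ S.card * ‖f 0‖ ≤ M ∧ ∀ z η, ‖z‖ ≤ 2 * R → ‖η‖ < R →
      (∀ s ∈ S, ‖z‖ ≠ ‖s‖) → f z ≠ 0 ∧
        ‖f (z + η) - f z‖ ≤ (Real.exp (‖η‖ * (12 * (Real.log (M / ‖f 0‖) + 1) / R +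
          (S.map fun s => |‖z‖ - ‖s‖|⁻¹).sum)) - 1) * ‖f z‖ := by
  -- `exists_exp_shift` needs a zero-free disc of radius 4R; tripling it gives the 12R of the
  -- hypothesis.
  obtain ⟨S, g, hg, hS, hfg, hne, hcard, hgM⟩ := exists_factorization hf h0 (r := 4 * R) (M := M)
    (by linarith) (by intro z hz; exact hM z (by linarith))
  refine ⟨S, hcard, fun z η hz hη hzS => ?_⟩
  have hzs : ∀ s ∈ S, z ≠ s := fun s hs h => hzS s hs (by rw [h])
  have hg0 : g 0 = f 0 := by simp [hfg 0]
  obtain ⟨δ, hδ, hδb⟩ := exists_exp_shift hg hR hne (fun w hw => hgM w (by linarith)) hz hη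
  rw [hg0] at hδb
  have hshift : f (z + η) = (Complex.exp δ * (S.map fun s => 1 + η / (z - s)).prod) * f z := by
    rw [hfg (z + η), hfg z, multiset_prod_shift S fun s hs => ⟨(hS s hs).1, hzs s hs⟩, hδ]
    ring
  constructor
  · rw [hfg]
    refine mul_ne_zero (fun h => ?_) (hne z (by linarith))
    obtain ⟨s, hs, h⟩ := Multiset.mem_map.1 (Multiset.prod_eq_zero_iff.1 h)
    have hs0 := (hS s hs).1
    rw [sub_eq_zero, eq_comm, div_eq_one_iff_eq hs0] at h
    exact hzs s hs h
  · rw [hshift, ← sub_one_mul, norm_mul]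
    gcongr
    refine (norm_mul_sub_one_le (norm_exp_sub_one_le_exp_norm δ)
      (b := Real.exp (‖η‖ * (S.map fun s => |‖z‖ - ‖s‖|⁻¹).sum)) ?_).trans ?_
    · have := norm_multiset_prod_one_add_sub_one_le (S.map fun s => η / (z - s))
      rw [Multiset.map_map, Multiset.map_map] at this
      refine this.trans (sub_le_sub_right (Real.exp_le_exp.2 ?_) _)
      rw [← Multiset.sum_map_mul_left]
      refine Multiset.sum_map_le_sum_map _ _ fun s hs => ?_
      simp only [Function.comp, norm_div]
      rw [div_eq_mul_inv]
      have hpos : 0 < |‖z‖ - ‖s‖| := abs_pos.2 (sub_ne_zero.2 (hzS s hs))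
      gcongr
      exact abs_norm_sub_norm_le z s
    · rw [← Real.exp_add, mul_add]
      gcongr
      linarith

theorem tendsto_growth_mul_rpow {ρ σ : ℝ} (hρ : 0 < ρ) (hσ : ρ < σ) (D : ℝ) :
    Tendsto (fun R : ℝ => ((12 * R) ^ ρ + D) * R ^ (-σ)) atTop (𝓝 0) := by
  have h1 := (tendsto_rpow_neg_atTop (sub_pos.2 hσ)).const_mul ((12 : ℝ) ^ ρ)
  have h2 := (tendsto_rpow_neg_atTop (hρ.trans hσ)).const_mul D
  have := h1.add h2
  simp only [mul_zero, add_zero] at this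
  refine this.congr' ?_
  filter_upwards [eventually_gt_atTop 0] with R hR
  rw [Real.mul_rpow (by norm_num) hR.le, neg_sub, sub_eq_add_neg, Real.rpow_add hR]
  ring

/-- The discs of radius 4R contain O(R^ρ) zeros. For ρ < σ < 1, averaging over [R, 2R] gives r with
Σ |r - |s||^(-σ) = O(R^(ρ-σ)), which tends to 0; merging the zeros of all the functions makes r
common. -/
theorem exists_good_circle_zero {ι : Type*} [Fintype ι] {f : ι → ℂ → ℂ}
    (hf : ∀ i, Differentiable ℂ (f i)) (h0 : ∀ i, f i 0 ≠ 0) {ρ R₀ : ℝ} (hρ : 0 < ρ) (hρ1 : ρ < 1)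
    (hb : ∀ i z, R₀ ≤ ‖z‖ → ‖f i z‖ ≤ Real.exp (‖z‖ ^ ρ)) {ε K : ℝ} (hε : 0 < ε)
    (R₁ : ℝ) :
    ∃ r, R₁ ≤ r ∧ ∀ i z, ‖z‖ = r → f i z ≠ 0 ∧
      ∀ η, ‖η‖ ≤ K → ‖f i (z + η) - f i z‖ ≤ ε * ‖f i z‖ := by
  obtain ⟨σ, hρσ, hσ1⟩ := exists_between hρ1
  have hσ0 : 0 < σ := hρ.trans hρσ
  set D : ℝ := ∑ i, |Real.log ‖f i 0‖| + 1 with hD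
  have hDi : ∀ i, -Real.log ‖f i 0‖ + 1 ≤ D := by
    intro i
    have := Finset.single_le_sum (f := fun i => |Real.log ‖f i 0‖|)
      (fun j _ => abs_nonneg _) (Finset.mem_univ i)
    have h2 := neg_abs_le (Real.log ‖f i 0‖)
    linarith
  set N : ℝ := (Fintype.card ι : ℝ) with hNdef
  have hN : 0 ≤ N := Nat.cast_nonneg _
  -- 12 comes from the zero-free part; the other term from at most 2X zeros for each of N functions.
  set C : ℝ := 12 + N * 2 * (2 / (1 - σ)) with hC
  have hσ' : 0 < 2 / (1 - σ) := div_pos two_pos (by linarith)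
  have hC0 : 0 < C := by positivity
  have hY := tendsto_growth_mul_rpow hρ hρσ D
  have hY1 : ∀ᶠ R : ℝ in atTop, C * (((12 * R) ^ ρ + D) * R ^ (-σ)) < 1 := by
    have := hY.const_mul C
    rw [mul_zero] at this
    exact this.eventually_lt_const one_pos
  have hY2 : ∀ᶠ R : ℝ in atTop,
      Real.exp (K * (C * (((12 * R) ^ ρ + D) * R ^ (-σ)))) - 1 < ε := by
    have h1 := (hY.const_mul C).const_mul K
    rw [mul_zero, mul_zero] at h1
    have h2 := ((Real.continuous_exp.tendsto 0).comp h1).sub_const 1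
    rw [Real.exp_zero, sub_self] at h2
    exact h2.eventually_lt_const hε
  obtain ⟨R, hR1, hR2, hRm, hRR₁, hRR₀, hRK⟩ := (hY1.and (hY2.and ((eventually_ge_atTop 1).and
    ((eventually_ge_atTop R₁).and ((eventually_ge_atTop R₀).and
      (eventually_gt_atTop K)))))).exists
  have hR : 0 < R := by linarith
  set X : ℝ := (12 * R) ^ ρ + D with hX
  set M : ℝ := Real.exp ((12 * R) ^ ρ) with hMdef
  have hM : ∀ i z, ‖z‖ = 12 * R → ‖f i z‖ ≤ M := by
    intro i z hz
    have := hb i z (by linarith)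
    rwa [hz] at this
  choose S hS1 hS2 using fun i => exists_shift_estimate (hf i) (h0 i) hR (hM i)
  have hlog : ∀ i, Real.log (M / ‖f i 0‖) + 1 ≤ X := by
    intro i
    rw [Real.log_div (Real.exp_pos _).ne' (norm_ne_zero_iff.2 (h0 i)), Real.log_exp]
    linarith [hDi i]
  have hcard : ∀ i, ((S i).card : ℝ) ≤ 2 * X := by
    intro i
    have hpos := norm_pos_iff.2 (h0 i)
    have h1 : (2 : ℝ) ^ (S i).card ≤ M / ‖f i 0‖ := by
      rw [le_div_iff₀ hpos]
      exact hS1 i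
    have h2 := Real.log_le_log (by positivity) h1
    rw [Real.log_pow] at h2
    have h3 : (1 / 2 : ℝ) ≤ Real.log 2 := by linarith [Real.log_two_gt_d9]
    have h4 : ((S i).card : ℝ) * (1 / 2) ≤ (S i).card * Real.log 2 := by gcongr
    linarith [hlog i]
  set T : Multiset ℝ := ∑ i, (S i).map fun s => ‖s‖ with hT
  have hTcard : (T.card : ℝ) ≤ N * (2 * X) := by
    rw [hT, Multiset.card_sum]
    push_cast
    refine (Finset.sum_le_card_nsmul _ _ (2 * X) fun i _ => ?_).trans (by simp [N])
    rw [Multiset.card_map]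
    exact hcard i
  obtain ⟨r, hr, hrT, hsum⟩ := exists_radius hσ0 hσ1 hR T
  have hRσ : 0 < R ^ (-σ) := Real.rpow_pos_of_pos hR _
  set Y : ℝ := X * R ^ (-σ) with hYdef
  have hsum' : (T.map fun t => |r - t| ^ (-σ)).sum ≤ N * 2 * (2 / (1 - σ)) * Y := by
    refine hsum.trans ?_
    calc (T.card : ℝ) * (2 / (1 - σ) * R ^ (-σ))
        ≤ (N * (2 * X)) * (2 / (1 - σ) * R ^ (-σ)) := by gcongr
      _ = _ := by rw [hYdef]; ring
  have hX0 : 0 ≤ X := by positivity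
  have hY0 : 0 ≤ Y := by positivity
  have hXR : X / R ≤ Y := by
    rw [hYdef, div_eq_mul_inv, ← Real.rpow_neg_one]
    gcongr
  have hle1 : (T.map fun t => |r - t| ^ (-σ)).sum ≤ 1 := by
    have : C * Y = 12 * Y + N * 2 * (2 / (1 - σ)) * Y := by rw [hC]; ring
    linarith
  -- A sum at most 1 forces every distance to be at least 1, so passing from exponent -σ to -1
  -- decreases each term.
  have hpow : ∀ t ∈ T, |r - t|⁻¹ ≤ |r - t| ^ (-σ) := by
    intro t ht
    have hpos : 0 < |r - t| := abs_pos.2 (sub_ne_zero.2 fun h => hrT (h ▸ ht))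
    have h1 : |r - t| ^ (-σ) ≤ 1 :=
      (Multiset.single_le_sum (fun x hx => by
        obtain ⟨u, -, rfl⟩ := Multiset.mem_map.1 hx
        positivity) _ (Multiset.mem_map_of_mem _ ht)).trans hle1
    have h2 : 1 ≤ |r - t| := by
      by_contra! hlt
      exact absurd h1 (not_le.2 (Real.one_lt_rpow_of_pos_of_lt_one_of_neg hpos hlt (by linarith)))
    rw [← Real.rpow_neg_one]
    exact Real.rpow_le_rpow_of_exponent_le h2 (by linarith)
  have hSsum : ∀ i, ((S i).map fun s => |r - ‖s‖|⁻¹).sum ≤ N * 2 * (2 / (1 - σ)) * Y := by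
    intro i
    refine le_trans ?_ hsum'
    have hle : (S i).map (fun s => ‖s‖) ≤ T :=
      Finset.single_le_sum (f := fun i => (S i).map fun s => ‖s‖) (fun j _ => Multiset.zero_le _)
        (Finset.mem_univ i)
    obtain ⟨U, hU⟩ := Multiset.le_iff_exists_add.1 hle
    calc ((S i).map fun s => |r - ‖s‖|⁻¹).sum
        ≤ ((S i).map fun s => |r - ‖s‖| ^ (-σ)).sum :=
          Multiset.sum_map_le_sum_map _ _ fun s hs =>
            hpow _ (Multiset.mem_of_le hle (Multiset.mem_map_of_mem _ hs))
      _ = (((S i).map fun s => ‖s‖).map fun t => |r - t| ^ (-σ)).sum := by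
          rw [Multiset.map_map]; rfl
      _ ≤ _ := by
          rw [hU, Multiset.map_add, Multiset.sum_add]
          exact le_add_of_nonneg_right (Multiset.sum_nonneg fun x hx => by
            obtain ⟨u, -, rfl⟩ := Multiset.mem_map.1 hx
            positivity)
  refine ⟨r, by linarith [hr.1], fun i z hz => ?_⟩
  have hzS : ∀ s ∈ S i, ‖z‖ ≠ ‖s‖ := by
    intro s hs h
    refine hrT ?_
    rw [← hz, h, hT, Multiset.mem_sum]
    exact ⟨i, Finset.mem_univ i, Multiset.mem_map_of_mem _ hs⟩
  refine ⟨(hS2 i z 0 (by linarith [hr.2]) (by simpa using hR) hzS).1, fun η hη => ?_⟩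
  refine (hS2 i z η (by linarith [hr.2]) (by linarith) hzS).2.trans ?_
  gcongr
  refine le_trans (sub_le_sub_right (Real.exp_le_exp.2 ?_) _) hR2.le
  have hbr : 12 * (Real.log (M / ‖f i 0‖) + 1) / R + ((S i).map fun s => |‖z‖ - ‖s‖|⁻¹).sum
      ≤ C * Y := by
    rw [hz]
    have h1 : 12 * (Real.log (M / ‖f i 0‖) + 1) / R ≤ 12 * Y := by
      calc 12 * (Real.log (M / ‖f i 0‖) + 1) / R ≤ 12 * X / R := by gcongr; exact hlog i
        _ = 12 * (X / R) := by ring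
        _ ≤ 12 * Y := by gcongr
    calc _ ≤ 12 * Y + N * 2 * (2 / (1 - σ)) * Y := add_le_add h1 (hSsum i)
      _ = C * Y := by rw [hC]; ring
  calc ‖η‖ * _ ≤ ‖η‖ * (C * Y) := by gcongr
    _ ≤ K * (C * Y) := by gcongr

end GoodCircles

/-! ### From order of growth to pointwise bounds -/

section Growth

theorem le_maxModulus {f : ℂ → ℂ} (hf : Continuous f) (z : ℂ) : ‖f z‖ ≤ maxModulus f ‖z‖ := by
  refine le_csSup ((isCompact_sphere 0 ‖z‖).image hf.norm).bddAbove ⟨z, by simp, rfl⟩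

theorem exists_growth_bound {f : ℂ → ℂ} (hf : Continuous f) (h : growthOrder f < 1) :
    ∃ ρ : ℝ, ρ < 1 ∧ ∃ R₀, ∀ z, R₀ ≤ ‖z‖ → ‖f z‖ ≤ Real.exp (‖z‖ ^ ρ) := by
  obtain ⟨ρ, h1, h2⟩ := EReal.lt_iff_exists_real_btwn.1 h
  refine ⟨ρ, by exact_mod_cast h2, ?_⟩
  have hev := (eventually_lt_of_limsup_lt h1).and (eventually_gt_atTop 1)
  obtain ⟨R₀, hR₀⟩ := eventually_atTop.1 hev
  refine ⟨R₀, fun z hz => (le_maxModulus hf z).trans ?_⟩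
  obtain ⟨h3, h4⟩ := hR₀ ‖z‖ hz
  have h3' := EReal.coe_lt_coe_iff.1 h3
  set m := maxModulus f ‖z‖
  set r := ‖z‖
  have hlog : 0 < Real.log r := Real.log_pos h4
  rw [div_lt_iff₀ hlog] at h3'
  have hr : 0 < r := by linarith
  have h5 : Real.posLog m ≤ r ^ ρ := by
    rcases le_or_gt (Real.posLog m) 0 with h | h
    · exact h.trans (by positivity)
    · rw [Real.rpow_def_of_pos hr, ← Real.log_le_iff_le_exp h]
      linarith [le_max_right 0 (Real.log (Real.posLog m)), Real.posLog_apply (x := Real.posLog m)]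
  rcases le_or_gt m 0 with h | h
  · exact h.trans (Real.exp_pos _).le
  · rw [← Real.log_le_iff_le_exp h]
    exact (le_max_right 0 (Real.log m)).trans (Real.posLog_apply.symm.trans_le h5)

/-- Growth bounds persist under translation, at the cost of a larger exponent. -/
theorem growth_bound_translate {f : ℂ → ℂ} {ρ ρ' R₀ : ℝ} (hρ : 0 < ρ) (hρ' : ρ < ρ')
    (h : ∀ z, R₀ ≤ ‖z‖ → ‖f z‖ ≤ Real.exp (‖z‖ ^ ρ)) (p : ℂ) :
    ∃ R₁, ∀ z, R₁ ≤ ‖z‖ → ‖f (p + z)‖ ≤ Real.exp (‖z‖ ^ ρ') := by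
  have h1 := (tendsto_rpow_atTop (sub_pos.2 hρ')).eventually_ge_atTop ((2 : ℝ) ^ ρ)
  obtain ⟨R₁, hR₁⟩ := eventually_atTop.1 (h1.and ((eventually_ge_atTop (R₀ + ‖p‖)).and
    ((eventually_ge_atTop ‖p‖).and (eventually_gt_atTop 0))))
  refine ⟨R₁, fun z hz => ?_⟩
  obtain ⟨a1, a2, a3, a4⟩ := hR₁ ‖z‖ hz
  have b1 : R₀ ≤ ‖p + z‖ := by
    have := norm_sub_norm_le z (-p)
    rw [norm_neg, sub_neg_eq_add, add_comm z p] at this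
    linarith
  refine (h _ b1).trans (Real.exp_le_exp.2 ?_)
  calc ‖p + z‖ ^ ρ ≤ (2 * ‖z‖) ^ ρ := by
        gcongr
        linarith [norm_add_le p z]
    _ = 2 ^ ρ * ‖z‖ ^ ρ := Real.mul_rpow (by norm_num) a4.le
    _ ≤ ‖z‖ ^ (ρ' - ρ) * ‖z‖ ^ ρ := by gcongr
    _ = ‖z‖ ^ ρ' := by rw [← Real.rpow_add a4]; ring_nf

theorem exists_common_growth_bound {ι : Type*} [Fintype ι] {f : ι → ℂ → ℂ}
    (hf : ∀ i, Continuous (f i)) (hρ : ∀ i, growthOrder (f i) < 1) (p : ℂ) :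
    ∃ ρ : ℝ, 0 < ρ ∧ ρ < 1 ∧ ∃ R₀, ∀ i z, R₀ ≤ ‖z‖ → ‖f i (p + z)‖ ≤ Real.exp (‖z‖ ^ ρ) := by
  choose σ hσ1 S hS using fun i => exists_growth_bound (hf i) (hρ i)
  obtain ⟨τ, hτ1, hτ⟩ : ∃ τ : ℝ, τ < 1 ∧ ∀ i, max (σ i) 0 < τ := by
    have h := eventually_all.2 fun i =>
      (Ioo_mem_nhdsLT (max_lt (hσ1 i) one_pos) : ∀ᶠ τ in 𝓝[<] (1 : ℝ), _)
    obtain ⟨τ, h1, h2⟩ := (h.and self_mem_nhdsWithin).exists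
    exact ⟨τ, h2, fun i => (h1 i).1⟩
  obtain ⟨ρ, hρ0, hρ1⟩ := exists_between (max_lt hτ1 one_pos)
  have hbd : ∀ i, ∃ R₁, ∀ z, R₁ ≤ ‖z‖ → ‖f i (p + z)‖ ≤ Real.exp (‖z‖ ^ ρ) := by
    intro i
    refine growth_bound_translate (ρ := max τ (ρ / 2)) (R₀ := max (S i) 1) ?_ ?_ (fun z hz => ?_) p
    · exact lt_max_of_lt_right (by linarith [le_max_right τ 0])
    · exact max_lt ((le_max_left _ _).trans_lt hρ0) (by linarith [le_max_right τ 0])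
    · refine (hS i z ((le_max_left _ _).trans hz)).trans (Real.exp_le_exp.2 ?_)
      refine Real.rpow_le_rpow_of_exponent_le ((le_max_right _ _).trans hz) ?_
      exact (le_max_left _ _).trans ((hτ i).le.trans (le_max_left _ _))
  choose R₁ hR₁ using hbd
  refine ⟨ρ, (le_max_right _ _).trans_lt hρ0, hρ1, ∑ i, |R₁ i|, fun i z hz => hR₁ i z ?_⟩
  exact (le_abs_self _).trans ((Finset.single_le_sum (f := fun i => |R₁ i|)
    (fun j _ => abs_nonneg _) (Finset.mem_univ i)).trans hz)

/-- Finitely many entire functions of order less than one, not vanishing at `p`, have common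
circles of arbitrarily large radius about `p` on which all bounded shifts are asymptotically
trivial. -/
theorem exists_good_circle {ι : Type*} [Fintype ι] {f : ι → ℂ → ℂ}
    (hf : ∀ i, Differentiable ℂ (f i)) (hρ : ∀ i, growthOrder (f i) < 1) {p : ℂ}
    (hp : ∀ i, f i p ≠ 0) {ε : ℝ} (hε : 0 < ε) (K R : ℝ) :
    ∃ r, R ≤ r ∧ ∀ i, ∀ z ∈ sphere p r, f i z ≠ 0 ∧
      ∀ η, ‖η‖ ≤ K → ‖f i (z + η) - f i z‖ ≤ ε * ‖f i z‖ := by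
  obtain ⟨ρ, hρ0, hρ1, R₀, hb⟩ := exists_common_growth_bound (fun i => (hf i).continuous) hρ p
  obtain ⟨r, hr, h⟩ := exists_good_circle_zero (f := fun i z => f i (p + z))
    (fun i => (hf i).comp (differentiable_id.const_add p)) (fun i => by simpa using hp i)
    hρ0 hρ1 hb hε R
  refine ⟨r, hr, fun i z hz => ?_⟩
  have := h i (z - p) (by rwa [mem_sphere, dist_eq_norm] at hz)
  simpa [← add_assoc] using this

end Growth

/-! ### Rigidity from good circles -/

section Consequences

theorem eq_zero_of_small_on_spheres {E : ℂ → ℂ} (hE : Differentiable ℂ E) {p : ℂ}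
    (h : ∀ ε > 0, ∀ R : ℝ, ∃ r, R ≤ r ∧ ∀ z ∈ sphere p r, ‖E z‖ ≤ ε) (z : ℂ) : E z = 0 := by
  rw [← norm_le_zero_iff]
  refine le_of_forall_pos_le_add fun ε hε => ?_
  obtain ⟨r, hr, hE'⟩ := h ε hε (dist z p + 1)
  rw [zero_add]
  exact norm_le_of_sphere hE (by linarith [dist_nonneg (x := z) (y := p)]) hE'
    (mem_closedBall.2 (by linarith))

/-- f(z + η) / f(z) - 1 is entire and small on good circles, hence zero; no Hadamard factorization
is needed. -/
theorem isConstant_of_ne_zero {f : ℂ → ℂ} (hf : Differentiable ℂ f) (hρ : growthOrder f < 1)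
    (hne : ∀ z, f z ≠ 0) : IsConstant f := by
  refine ⟨f 0, fun η => ?_⟩
  have hdiff : Differentiable ℂ fun z => f (z + η) / f z - 1 :=
    ((hf.comp (differentiable_id.add_const η)).div hf hne).sub_const 1
  have := eq_zero_of_small_on_spheres hdiff (p := 0) (fun ε hε R => by
    obtain ⟨r, hr, h⟩ := exists_good_circle (f := fun _ : Unit => f) (fun _ => hf) (fun _ => hρ)
      (p := 0) (fun _ => hne 0) hε ‖η‖ R
    refine ⟨r, hr, fun z hz => ?_⟩
    obtain ⟨h1, h2⟩ := h () z hz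
    rw [div_sub_one h1, norm_div, div_le_iff₀ (norm_pos_iff.2 h1)]
    exact h2 η le_rfl) 0
  rw [zero_add] at this
  rw [sub_eq_zero, div_eq_one_iff_eq (hne 0)] at this
  exact this

/-- The falling powers of a nonzero entire function of order less than one do not vanish on a
progression `u, u + 1, u + 2, …`. -/
theorem exists_fallingPow_add_ne_zero {f : ℂ → ℂ} (hf : Differentiable ℂ f)
    (hρ : growthOrder f < 1) {p : ℂ} (hp : f p ≠ 0) (n : ℕ) (u : ℂ) :
    ∃ k : ℕ, fallingPow f n (u + k) ≠ 0 := by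
  obtain ⟨r, hr, h⟩ := exists_good_circle (f := fun _ : Unit => f) (fun _ => hf) (fun _ => hρ)
    (p := p) (fun _ => hp) (ε := 1 / 2) (by norm_num) (n + 1) (‖u - p‖ + 1)
  have hex : ∃ k : ℕ, r ≤ ‖u - p + k‖ := by
    obtain ⟨k, hk⟩ := exists_nat_ge (r + ‖u - p‖)
    refine ⟨k, ?_⟩
    have := norm_sub_norm_le (k : ℂ) (-(u - p))
    rw [norm_neg, sub_neg_eq_add, Complex.norm_natCast, add_comm] at this
    linarith
  classical
  -- The first term leaving the disc overshoots by at most 1, so its radial projection w to the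
  -- circle is within 1. The shift reaching u + k - j then has norm at most n + 1, and a zero there
  -- contradicts ε = 1/2.
  set k := Nat.find hex with hk
  have hk1 : r ≤ ‖u - p + k‖ := Nat.find_spec hex
  have hr0 : 0 < r := by linarith [norm_nonneg (u - p)]
  have hk0 : k ≠ 0 := by
    intro h0
    rw [h0] at hk1
    simp only [Nat.cast_zero, add_zero] at hk1
    linarith
  obtain ⟨m, hm⟩ := Nat.exists_eq_succ_of_ne_zero hk0
  have hk2 : ‖u - p + k‖ ≤ r + 1 := by
    have h1 := Nat.find_min hex (show m < Nat.find hex by omega)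
    rw [not_le] at h1
    have h2 : u - p + k = (u - p + m) + 1 := by rw [hm]; push_cast; ring
    rw [h2]
    refine (norm_add_le _ _).trans ?_
    rw [norm_one]
    linarith
  set v := u - p + (k : ℂ) with hv
  have hv0 : 0 < ‖v‖ := by linarith
  set w : ℂ := ((r / ‖v‖ : ℝ) : ℂ) * v with hw
  have hwr : ‖w‖ = r := by
    rw [hw, norm_mul, Complex.norm_real, Real.norm_of_nonneg (by positivity)]
    field_simp
  have hvw : ‖v - w‖ ≤ 1 := by
    have : v - w = ((1 - r / ‖v‖ : ℝ) : ℂ) * v := by rw [hw]; push_cast; ring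
    rw [this, norm_mul, Complex.norm_real, Real.norm_of_nonneg
      (sub_nonneg.2 ((div_le_one hv0).2 hk1)), sub_mul, div_mul_cancel₀ _ hv0.ne']
    linarith
  refine ⟨k, fun h0 => ?_⟩
  obtain ⟨j, hj, hj0⟩ := Finset.prod_eq_zero_iff.1 h0
  have hjn : (j : ℝ) ≤ n := by exact_mod_cast (Finset.mem_range.1 hj).le
  obtain ⟨h1, h2⟩ := h () (p + w) (by simp [hwr])
  have h3 := h2 (v - w - j) ((norm_sub_le _ _).trans (by
    rw [Complex.norm_natCast]; linarith))
  have h4 : p + w + (v - w - j) = u + k - j := by rw [hv]; ring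
  rw [h4, hj0, zero_sub, norm_neg] at h3
  have := norm_pos_iff.2 h1
  linarith

end Consequences

/-! ### Falling powers and their zeros -/

section FallingPow

theorem differentiable_fallingPow {f : ℂ → ℂ} (hf : Differentiable ℂ f) (n : ℕ) :
    Differentiable ℂ (fallingPow f n) := by
  unfold fallingPow
  fun_prop

theorem fallingPow_succ (f : ℂ → ℂ) (m : ℕ) (z : ℂ) :
    fallingPow f (m + 1) z = fallingPow f m z * f (z - m) :=
  Finset.prod_range_succ _ _

theorem fallingPow_succ_add_one (f : ℂ → ℂ) (m : ℕ) (z : ℂ) :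
    fallingPow f (m + 1) (z + 1) = fallingPow f m z * f (z + 1) := by
  simp only [fallingPow, Finset.prod_range_succ', Nat.cast_zero, sub_zero]
  congr 1
  refine Finset.prod_congr rfl fun j _ => ?_
  push_cast
  ring_nf

theorem fallingPow_eq_zero_of_eq_zero {f : ℂ → ℂ} {n j : ℕ} (hj : j < n) {z : ℂ}
    (h : f (z - j) = 0) : fallingPow f n z = 0 :=
  Finset.prod_eq_zero (Finset.mem_range.2 hj) h

theorem exists_of_fallingPow_eq_zero {f : ℂ → ℂ} {n : ℕ} {z : ℂ} (h : fallingPow f n z = 0) :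
    ∃ j < n, f (z - j) = 0 := by
  obtain ⟨j, hj, h⟩ := Finset.prod_eq_zero_iff.1 h
  exact ⟨j, Finset.mem_range.1 hj, h⟩

/-- A zero w of f produces the run w, w + 1, ..., w + n - 1 of zeros of the falling power. -/
theorem fallingPow_neighbour_eq_zero {f : ℂ → ℂ} {n : ℕ} (hn : 2 ≤ n) {z : ℂ}
    (h : fallingPow f n z = 0) : fallingPow f n (z - 1) = 0 ∨ fallingPow f n (z + 1) = 0 := by
  obtain ⟨j, hj, h⟩ := exists_of_fallingPow_eq_zero h
  rcases j with _ | j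
  · right
    refine fallingPow_eq_zero_of_eq_zero (j := 1) (by omega) ?_
    simpa using h
  · left
    refine fallingPow_eq_zero_of_eq_zero (j := j) (by omega) ?_
    rw [← h]
    push_cast
    ring_nf

theorem isConstant_of_fallingPow_ne_zero {f : ℂ → ℂ} (hf : Differentiable ℂ f)
    (hρ : growthOrder f < 1) {n : ℕ} (hn : 1 ≤ n) (h : ∀ z, fallingPow f n z ≠ 0) :
    IsConstant f :=
  isConstant_of_ne_zero hf hρ fun z hz =>
    h z (fallingPow_eq_zero_of_eq_zero (j := 0) hn (by simpa using hz))

end FallingPow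

/-! ### Shifting primality excludes common zeros -/

section ShiftingPrime

/-- By Newton's forward difference formula, vanishing of all differences at u would kill f at every
u + k. -/
theorem exists_isZeroOfLength {f : ℂ → ℂ} {u : ℂ} (h0 : f u = 0) (h : ∃ k : ℕ, f (u + k) ≠ 0) :
    ∃ m, IsZeroOfLength f u m := by
  classical
  have hex : ∃ m, (fwdDiff (1 : ℂ))^[m] f u ≠ 0 := by
    by_contra! hall
    obtain ⟨k, hk⟩ := h
    refine hk ?_
    have := shift_eq_sum_fwdDiff_iter (1 : ℂ) f k u
    simpa [hall] using this
  refine ⟨Nat.find hex, ?_, fun k hk => ?_, Nat.find_spec hex⟩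
  · rw [Nat.one_le_iff_ne_zero]
    intro hz
    have := Nat.find_spec hex
    rw [hz] at this
    exact this h0
  · simpa using Nat.find_min hex hk

/-- Two linear factors with zeros one apart multiply to a falling factorial of length 2, so m₁ = n₁
= 1 suffices. -/
theorem isCommonShiftingDivisor_of_adjacent {f g : ℂ → ℂ} (hf : Differentiable ℂ f)
    (hg : Differentiable ℂ g) (hf' : ∀ u, ∃ k : ℕ, f (u + k) ≠ 0)
    (hg' : ∀ u, ∃ k : ℕ, g (u + k) ≠ 0) {u v : ℂ} (huv : v = u + 1 ∨ u = v + 1)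
    (hu : f u = 0) (hv : g v = 0) : ∃ z₀, IsCommonShiftingDivisor f g z₀ := by
  obtain ⟨m, hm⟩ := exists_isZeroOfLength hu (hf' u)
  obtain ⟨l, hl⟩ := exists_isZeroOfLength hv (hg' v)
  obtain ⟨F, hF, hfF⟩ := exists_eq_sub_mul hf hu
  obtain ⟨G, hG, hgG⟩ := exists_eq_sub_mul hg hv
  have h1 : ∀ x z : ℂ, fallingPow (fun w => w - x) 1 z = z - x := by
    intro x z
    simp [fallingPow]
  have h2 : ∀ x z : ℂ, fallingPow (fun w => w - x) (1 + 1) z = (z - x) * (z - 1 - x) := by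
    intro x z
    simp [fallingPow, Finset.prod_range_succ]
  rcases huv with rfl | rfl
  · refine ⟨u, u, u + 1, m, l, hm, hl, 1, 1, le_rfl, hm.1, le_rfl, hl.1, F, G, hF, hG, ?_, ?_,
      Or.inl rfl, fun z => ?_⟩
    · simpa only [h1] using hfF
    · simpa only [h1] using hgG
    · rw [h2, hfF, hgG]
      ring
  · refine ⟨v, v + 1, v, m, l, hm, hl, 1, 1, le_rfl, hm.1, le_rfl, hl.1, F, G, hF, hG, ?_, ?_,
      Or.inr rfl, fun z => ?_⟩
    · simpa only [h1] using hfF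
    · simpa only [h1] using hgG
    · rw [h2, hfF, hgG]
      ring

/-- For `n ≥ 2` shifting-prime falling powers have no common zero. -/
theorem RelativelyShiftingPrime.ne_zero_of_eq_zero {x y : ℂ → ℂ} (hx : Differentiable ℂ x)
    (hy : Differentiable ℂ y) (hρx : growthOrder x < 1) (hρy : growthOrder y < 1)
    (hx0 : ∃ p, x p ≠ 0) (hy0 : ∃ p, y p ≠ 0) {n : ℕ} (hn : 2 ≤ n)
    (h : RelativelyShiftingPrime (fallingPow x n) (fallingPow y n)) {z : ℂ}
    (hz : fallingPow x n z = 0) : fallingPow y n z ≠ 0 := by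
  obtain ⟨p, hp⟩ := hx0
  obtain ⟨q, hq⟩ := hy0
  intro hz'
  have key := fun u v huv hu hv => isCommonShiftingDivisor_of_adjacent (u := u) (v := v)
    (differentiable_fallingPow hx n) (differentiable_fallingPow hy n)
    (exists_fallingPow_add_ne_zero hx hρx hp n) (exists_fallingPow_add_ne_zero hy hρy hq n)
    huv hu hv
  rcases fallingPow_neighbour_eq_zero hn hz with h' | h'
  · obtain ⟨z₀, hz₀⟩ := key (z - 1) z (Or.inl (by ring)) h' hz'
    exact h z₀ hz₀
  · obtain ⟨z₀, hz₀⟩ := key (z + 1) z (Or.inr rfl) h' hz'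
    exact h z₀ hz₀

end ShiftingPrime

/-! ### Entire quotients -/

section Division

/-- X / B and Y / A agree where both are defined, and without common zeros of A and B their domains
cover the plane. -/
theorem exists_entire_quotient {A B X Y : ℂ → ℂ} (hA : Differentiable ℂ A)
    (hB : Differentiable ℂ B) (hX : Differentiable ℂ X) (hY : Differentiable ℂ Y)
    (h : ∀ z, A z * X z = B z * Y z) (hAB : ∀ z, A z = 0 → B z ≠ 0) :
    ∃ V : ℂ → ℂ, Differentiable ℂ V ∧ ∀ z, X z = B z * V z := by
  classical
  have hcross : ∀ z, A z ≠ 0 → B z ≠ 0 → X z / B z = Y z / A z := by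
    intro z h1 h2
    rw [div_eq_div_iff h2 h1]
    linear_combination h z
  refine ⟨fun z => if B z = 0 then Y z / A z else X z / B z, fun z => ?_, fun z => ?_⟩
  · by_cases hz : B z = 0
    · have hAz : A z ≠ 0 := fun h0 => hAB z h0 hz
      refine ((hY z).div (hA z) hAz).congr_of_eventuallyEq ?_
      filter_upwards [hA.continuous.continuousAt.eventually_ne hAz] with w hw
      split_ifs with h0
      · rfl
      · exact hcross w hw h0
    · refine ((hX z).div (hB z) hz).congr_of_eventuallyEq ?_
      filter_upwards [hB.continuous.continuousAt.eventually_ne hz] with w hw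
      simp [hw]
  · by_cases hz : B z = 0
    · have hAz : A z ≠ 0 := fun h0 => hAB z h0 hz
      have := h z
      rw [hz, zero_mul] at this
      rw [hz, zero_mul]
      exact (mul_eq_zero.1 this).resolve_left hAz
    · simp only [hz, if_false]
      field_simp

theorem eventually_ne_zero {f : ℂ → ℂ} (hf : Differentiable ℂ f) (h : ∃ p, f p ≠ 0) :
    ∀ᶠ z in 𝓝[≠] (0 : ℂ), f z ≠ 0 := by
  have han : AnalyticOnNhd ℂ f Set.univ := fun z _ => hf.analyticAt z
  rcases (hf.analyticAt 0).eventually_eq_zero_or_eventually_ne_zero with h0 | h0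
  · obtain ⟨p, hp⟩ := h
    exact absurd (han.eqOn_zero_of_preconnected_of_eventuallyEq_zero isPreconnected_univ
      (Set.mem_univ 0) h0 (Set.mem_univ p)) hp
  · exact h0

end Division

/-! ### Casorati determinants and their size on good circles -/

section Casorati

variable {a b c : ℂ → ℂ}

/-- The reduced Casorati determinant of two falling powers of length `m + 1`. -/
def casorati (m : ℕ) (x y : ℂ → ℂ) : ℂ → ℂ :=
  fun z => x (z - m) * y (z + 1) - x (z + 1) * y (z - m)

theorem differentiable_casorati {x y : ℂ → ℂ} (hx : Differentiable ℂ x) (hy : Differentiable ℂ y)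
    (m : ℕ) : Differentiable ℂ (casorati m x y) := by
  unfold casorati
  fun_prop

theorem norm_casorati_le {x y : ℂ → ℂ} {m : ℕ} {ε : ℝ} (h1 : ε ≤ 1) {z : ℂ}
    (hx : ∀ η : ℂ, ‖η‖ ≤ m + 1 → ‖x (z + η) - x z‖ ≤ ε * ‖x z‖)
    (hy : ∀ η : ℂ, ‖η‖ ≤ m + 1 → ‖y (z + η) - y z‖ ≤ ε * ‖y z‖) :
    ‖casorati m x y z‖ ≤ 6 * ε * (‖x z‖ * ‖y z‖) := by
  have hη1 : ‖(1 : ℂ)‖ ≤ m + 1 := by simp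
  have hη2 : ‖-(m : ℂ)‖ ≤ m + 1 := by simp
  have dx1 := hx 1 hη1
  have dx2 := hx _ hη2
  have dy1 := hy 1 hη1
  have dy2 := hy _ hη2
  rw [← sub_eq_add_neg] at dx2 dy2
  set X := ‖x z‖
  set Y := ‖y z‖
  have hX : 0 ≤ X := norm_nonneg _
  have hY : 0 ≤ Y := norm_nonneg _
  have hX' : 0 ≤ ε * X := (norm_nonneg _).trans dx1
  have hy1 : ‖y (z + 1)‖ ≤ 2 * Y := by
    have := norm_le_norm_add_norm_sub' (y (z + 1)) (y z)
    nlinarith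
  have hy2 : ‖y (z - m)‖ ≤ 2 * Y := by
    have := norm_le_norm_add_norm_sub' (y (z - m)) (y z)
    nlinarith
  -- The main terms x(z) y(z) cancel; each of the three remaining pieces contributes 2ε, whence the
  -- 6.
  have hid : casorati m x y z = (x (z - m) - x z) * y (z + 1) - (x (z + 1) - x z) * y (z - m)
      + x z * ((y (z + 1) - y z) - (y (z - m) - y z)) := by
    unfold casorati
    ring
  rw [hid]
  have e1 : ‖(x (z - m) - x z) * y (z + 1)‖ ≤ ε * X * (2 * Y) := by
    rw [norm_mul]; gcongr
  have e2 : ‖(x (z + 1) - x z) * y (z - m)‖ ≤ ε * X * (2 * Y) := by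
    rw [norm_mul]; gcongr
  have e3 : ‖x z * ((y (z + 1) - y z) - (y (z - m) - y z))‖ ≤ X * (ε * Y + ε * Y) := by
    rw [norm_mul]
    gcongr
    exact norm_sub_le_of_le dy1 dy2
  refine (norm_add_le_of_le (norm_sub_le_of_le e1 e2) e3).trans (le_of_eq ?_)
  ring

theorem pow_le_two_pow_mul_norm_fallingPow {x : ℂ → ℂ} {m : ℕ} {ε : ℝ} (h1 : ε ≤ 1 / 2) {z : ℂ}
    (hx : ∀ η : ℂ, ‖η‖ ≤ m + 1 → ‖x (z + η) - x z‖ ≤ ε * ‖x z‖) :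
    ‖x z‖ ^ m ≤ 2 ^ m * ‖fallingPow x m z‖ := by
  have : ‖x z‖ ^ m = ∏ _j ∈ Finset.range m, ‖x z‖ := by simp
  have h2 : (2 : ℝ) ^ m = ∏ _j ∈ Finset.range m, 2 := by simp
  rw [this, h2, fallingPow, norm_prod, ← Finset.prod_mul_distrib]
  refine Finset.prod_le_prod (fun _ _ => norm_nonneg _) fun j hj => ?_
  have hj' : (j : ℝ) ≤ m := by exact_mod_cast (Finset.mem_range.1 hj).le
  have := hx (-(j : ℂ)) (by rw [norm_neg, Complex.norm_natCast]; linarith)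
  rw [← sub_eq_add_neg] at this
  have h3 := norm_sub_norm_le (x z) (x (z - j))
  rw [norm_sub_rev] at h3
  nlinarith [norm_nonneg (x z)]

theorem fallingPow_mul_casorati {m : ℕ}
    (hsum : ∀ z, fallingPow a (m + 1) z + fallingPow b (m + 1) z = fallingPow c (m + 1) z)
    (z : ℂ) :
    fallingPow b m z * casorati m a b z = fallingPow c m z * casorati m a c z ∧
      fallingPow a m z * casorati m a b z = fallingPow c m z * casorati m c b z := by
  have h1 := hsum z
  have h2 := hsum (z + 1)
  simp only [fallingPow_succ] at h1
  simp only [fallingPow_succ_add_one] at h2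
  unfold casorati
  constructor
  · linear_combination a (z - m) * h2 - a (z + 1) * h1
  · linear_combination b (z + 1) * h1 - b (z - m) * h2

/-- On a good circle the quotient `V` of the Casorati determinant is small compared to each of the
three products of two functions divided by a power of the third one. -/
theorem norm_quotient_le {m : ℕ} {V : ℂ → ℂ} {z : ℂ} {ε : ℝ} (hε : 0 < ε) (hε1 : ε ≤ 1 / 2)
    {x y w : ℂ → ℂ} (hV : fallingPow w m z * V z = casorati m x y z)
    (hx : ∀ η : ℂ, ‖η‖ ≤ m + 1 → ‖x (z + η) - x z‖ ≤ ε * ‖x z‖)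
    (hy : ∀ η : ℂ, ‖η‖ ≤ m + 1 → ‖y (z + η) - y z‖ ≤ ε * ‖y z‖)
    (hw : ∀ η : ℂ, ‖η‖ ≤ m + 1 → ‖w (z + η) - w z‖ ≤ ε * ‖w z‖) :
    ‖w z‖ ^ m * ‖V z‖ ≤ 6 * 2 ^ m * ε * (‖x z‖ * ‖y z‖) := by
  have h1 := norm_casorati_le (by linarith) hx hy
  rw [← hV, norm_mul] at h1
  have h2 := pow_le_two_pow_mul_norm_fallingPow hε1 hw
  calc ‖w z‖ ^ m * ‖V z‖ ≤ 2 ^ m * ‖fallingPow w m z‖ * ‖V z‖ := by gcongr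
    _ = 2 ^ m * (‖fallingPow w m z‖ * ‖V z‖) := by ring
    _ ≤ 2 ^ m * (6 * ε * (‖x z‖ * ‖y z‖)) := by gcongr
    _ = _ := by ring

/-- Multiplying the three estimates for the quotient. -/
theorem quotient_cube_le {A B C V D : ℝ} (hA : 0 < A) (hB : 0 < B) (hC : 0 < C) (hV : 0 ≤ V)
    {k : ℕ} (h1 : C ^ (k + 2) * V ≤ D * (A * B)) (h2 : B ^ (k + 2) * V ≤ D * (A * C))
    (h3 : A ^ (k + 2) * V ≤ D * (C * B)) : V ^ 3 * (A * B * C) ^ k ≤ D ^ 3 := by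
  have h12 := mul_le_mul h1 h2 (by positivity) ((by positivity : 0 ≤ C ^ (k + 2) * V).trans h1)
  have h123 := mul_le_mul h12 h3 (by positivity) ((by positivity : 0 ≤
    C ^ (k + 2) * V * (B ^ (k + 2) * V)).trans h12)
  have hP : 0 < (A * B * C) ^ 2 := by positivity
  refine le_of_mul_le_mul_right ?_ hP
  calc V ^ 3 * (A * B * C) ^ k * (A * B * C) ^ 2
      = C ^ (k + 2) * V * (B ^ (k + 2) * V) * (A ^ (k + 2) * V) := by
        simp only [pow_add, mul_pow]; ring
    _ ≤ _ := h123
    _ = _ := by ring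

theorem quotient_sq_le {X Y K V D : ℝ} (hX : 0 < X) (hY : 0 < Y) (hV : 0 ≤ V)
    (h1 : X * V ≤ D * (K * Y)) (h2 : Y * V ≤ D * (K * X)) : V ^ 2 ≤ (D * K) ^ 2 := by
  have h12 := mul_le_mul h1 h2 (by positivity) ((by positivity : 0 ≤ X * V).trans h1)
  have hP : 0 < X * Y := by positivity
  refine le_of_mul_le_mul_right ?_ hP
  calc V ^ 2 * (X * Y) = X * V * (Y * V) := by ring
    _ ≤ _ := h12
    _ = _ := by ring

end Casorati

/-! ### Vanishing of the Casorati determinant and conclusion -/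

section Fermat

variable {a b c : ℂ → ℂ}

/-- An entire function controlling the quotient `V` on the good circles. -/
theorem exists_control {V : ℂ → ℂ} (ha : Differentiable ℂ a) (hb : Differentiable ℂ b)
    (hc : Differentiable ℂ c) (hV : Differentiable ℂ V) {m : ℕ} (hm : 1 ≤ m)
    (h : 2 ≤ m ∨ IsConstant a ∨ IsConstant b ∨ IsConstant c) :
    ∃ E : ℂ → ℂ, Differentiable ℂ E ∧
      (∀ z, V z ≠ 0 → a z ≠ 0 → b z ≠ 0 → c z ≠ 0 → E z ≠ 0) ∧
      ∃ Q : ℝ, 0 ≤ Q ∧ ∀ ε, 0 < ε → ε ≤ 1 / 2 → ∀ z, a z ≠ 0 → b z ≠ 0 → c z ≠ 0 →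
        ‖c z‖ ^ m * ‖V z‖ ≤ 6 * 2 ^ m * ε * (‖a z‖ * ‖b z‖) →
        ‖b z‖ ^ m * ‖V z‖ ≤ 6 * 2 ^ m * ε * (‖a z‖ * ‖c z‖) →
        ‖a z‖ ^ m * ‖V z‖ ≤ 6 * 2 ^ m * ε * (‖c z‖ * ‖b z‖) → ‖E z‖ ≤ Q * ε := by
  have hsq : ∀ k ε : ℝ, 0 < ε → ε ≤ 1 / 2 → (6 * 2 ^ 1 * ε * k) ^ 2 ≤ (12 * k) ^ 2 * ε := by
    intro k ε h0 h1
    have : (6 * 2 ^ 1 * ε * k) ^ 2 = (12 * k) ^ 2 * (ε * ε) := by ring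
    rw [this]
    gcongr
    nlinarith
  obtain h2 | ⟨rfl, hcon⟩ : 2 ≤ m ∨ (m = 1 ∧ (IsConstant a ∨ IsConstant b ∨ IsConstant c)) := by
    rcases h with h | h
    · exact Or.inl h
    · rcases hm.lt_or_eq with h' | h'
      · exact Or.inl h'
      · exact Or.inr ⟨h'.symm, h⟩
  · obtain ⟨k, rfl⟩ := Nat.exists_eq_add_of_le' h2
    -- Here k = m - 2; this is where m ≥ 2 is needed for E to be entire.
    refine ⟨fun z => V z ^ 3 * (a z * b z * c z) ^ k, by fun_prop, ?_, (6 * 2 ^ (k + 2)) ^ 3,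
      by positivity, ?_⟩
    · intro z h1 h2 h3 h4
      positivity
    · intro ε hε hε1 z h1 h2 h3 e1 e2 e3
      rw [norm_mul, norm_pow, norm_pow, norm_mul, norm_mul]
      refine (quotient_cube_le (norm_pos_iff.2 h1) (norm_pos_iff.2 h2) (norm_pos_iff.2 h3)
        (norm_nonneg _) e1 e2 e3).trans ?_
      rw [mul_pow _ ε]
      gcongr
      nlinarith [mul_pos hε hε]
  -- For m = 1, multiplying the two estimates with the constant on the right cancels the other two
  -- functions.
  · simp only [pow_one (_ : ℝ)] at *
    rcases hcon with ⟨k, hk⟩ | ⟨k, hk⟩ | ⟨k, hk⟩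
    all_goals
      refine ⟨fun z => V z ^ 2, by fun_prop, fun z h1 _ _ _ => pow_ne_zero 2 h1,
        (12 * ‖k‖) ^ 2, by positivity, ?_⟩
      intro ε hε hε1 z h1 h2 h3 e1 e2 e3
      rw [norm_pow]
      refine le_trans ?_ (hsq ‖k‖ ε hε hε1)
      rw [hk z] at e1 e2 e3
    · refine quotient_sq_le (norm_pos_iff.2 h3) (norm_pos_iff.2 h2) (norm_nonneg _) ?_ ?_
      · simpa using e1
      · simpa using e2
    · refine quotient_sq_le (norm_pos_iff.2 h3) (norm_pos_iff.2 h1) (norm_nonneg _) ?_ ?_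
      · rw [mul_comm ‖k‖]
        simpa using e1
      · rw [mul_comm ‖k‖]
        simpa using e3
    · refine quotient_sq_le (norm_pos_iff.2 h2) (norm_pos_iff.2 h1) (norm_nonneg _) ?_ ?_
      · rw [mul_comm ‖k‖]
        simpa using e2
      · simpa using e3

theorem casorati_eq_zero (ha : Differentiable ℂ a) (hb : Differentiable ℂ b)
    (hc : Differentiable ℂ c) (hρa : growthOrder a < 1) (hρb : growthOrder b < 1)
    (hρc : growthOrder c < 1) (ha0 : ∃ p, a p ≠ 0) (hb0 : ∃ p, b p ≠ 0) (hc0 : ∃ p, c p ≠ 0)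
    {m : ℕ} (hm : 1 ≤ m) (h : 2 ≤ m ∨ IsConstant a ∨ IsConstant b ∨ IsConstant c)
    (hsum : ∀ z, fallingPow a (m + 1) z + fallingPow b (m + 1) z = fallingPow c (m + 1) z)
    (hbc : ∀ z, fallingPow b m z = 0 → fallingPow c m z ≠ 0) (z : ℂ) :
    casorati m a b z = 0 := by
  obtain ⟨p, hpa, hpb, hpc⟩ := ((eventually_ne_zero ha ha0).and
    ((eventually_ne_zero hb hb0).and (eventually_ne_zero hc hc0))).exists
  obtain ⟨V, hV, hVab⟩ := exists_entire_quotient (differentiable_fallingPow hb m)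
    (differentiable_fallingPow hc m) (differentiable_casorati ha hb m)
    (differentiable_casorati ha hc m) (fun z => (fallingPow_mul_casorati hsum z).1) hbc
  obtain ⟨E, hE, hEV, Q, hQ, hEQ⟩ := exists_control ha hb hc hV hm h
  have hgood : ∀ ε > 0, ε ≤ 1 / 2 → ∀ R : ℝ, ∃ r, R ≤ r ∧ ∀ z ∈ sphere p r,
      a z ≠ 0 ∧ b z ≠ 0 ∧ c z ≠ 0 ∧ ‖E z‖ ≤ Q * ε := by
    intro ε hε hε1 R
    obtain ⟨r, hr, hf⟩ := exists_good_circle (f := ![a, b, c])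
      (by simp [Fin.forall_fin_succ, ha, hb, hc]) (by simp [Fin.forall_fin_succ, hρa, hρb, hρc])
      (p := p) (by simp [Fin.forall_fin_succ, hpa, hpb, hpc]) hε (m + 1) (max R (m + 1))
    refine ⟨r, (le_max_left _ _).trans hr, fun z hz => ?_⟩
    obtain ⟨az, da⟩ := hf 0 z hz
    obtain ⟨bz, db⟩ := hf 1 z hz
    obtain ⟨cz, dc⟩ := hf 2 z hz
    simp only [Matrix.cons_val_zero, Matrix.cons_val_one, Matrix.cons_val] at az bz cz da db dc
    obtain ⟨hB, hA⟩ := fallingPow_mul_casorati hsum z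
    have hC : fallingPow c m z ≠ 0 := by
      have := pow_le_two_pow_mul_norm_fallingPow hε1 dc
      intro h0
      rw [h0, norm_zero, mul_zero] at this
      exact absurd this (not_le.2 (pow_pos (norm_pos_iff.2 cz) m))
    refine ⟨az, bz, cz, hEQ ε hε hε1 z az bz cz
      (norm_quotient_le hε hε1 (hVab z).symm da db dc)
      (norm_quotient_le hε hε1 (mul_left_cancel₀ hC ?_) da dc db)
      (norm_quotient_le hε hε1 (mul_left_cancel₀ hC ?_) dc db da)⟩
    · rw [← hB, hVab z]
      ring
    · rw [← hA, hVab z]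
      ring
  have hE0 : ∀ z, E z = 0 := eq_zero_of_small_on_spheres hE (p := p) fun ε hε R => by
    obtain ⟨r, hr, h⟩ := hgood (min (1 / 2) (ε / (Q + 1))) (by positivity) (min_le_left _ _) R
    refine ⟨r, hr, fun z hz => (h z hz).2.2.2.trans ?_⟩
    calc Q * min (1 / 2) (ε / (Q + 1)) ≤ (Q + 1) * (ε / (Q + 1)) := by
          gcongr
          · linarith
          · exact min_le_right _ _
      _ = ε := by field_simp
  -- Since a, b, c do not vanish on good circles, E = 0 gives V = 0 there, and the maximum principle
  -- applies again.
  have hV0 : ∀ z, V z = 0 := eq_zero_of_small_on_spheres hV (p := p) fun ε hε R => by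
    obtain ⟨r, hr, h⟩ := hgood (1 / 2) (by norm_num) le_rfl R
    refine ⟨r, hr, fun z hz => ?_⟩
    obtain ⟨h1, h2, h3, -⟩ := h z hz
    have : V z = 0 := by
      by_contra h0
      exact hEV z h0 h1 h2 h3 (hE0 z)
    rw [this, norm_zero]
    exact hε.le
  rw [hVab, hV0, mul_zero]

/-- If two falling powers have no common zero and their quotient is `1`-periodic, the underlying
function of the first one is constant. -/
theorem isConstant_of_proportional {x y : ℂ → ℂ} (hx : Differentiable ℂ x)
    (hρ : growthOrder x < 1) (hx0 : ∃ p, x p ≠ 0) {n : ℕ} (hn : 1 ≤ n)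
    (hxy : ∀ z, fallingPow x n z = 0 → fallingPow y n z ≠ 0)
    (h : ∀ z, fallingPow x n z * fallingPow y n (z + 1) =
      fallingPow x n (z + 1) * fallingPow y n z) : IsConstant x := by
  refine isConstant_of_fallingPow_ne_zero hx hρ hn fun u hu => ?_
  obtain ⟨p, hp⟩ := hx0
  obtain ⟨k, hk⟩ := exists_fallingPow_add_ne_zero hx hρ hp n u
  refine hk ?_
  clear hk
  induction k with
  | zero => simpa using hu
  | succ k ih =>
    have h1 := h (u + k)
    rw [ih, zero_mul, eq_comm, mul_eq_zero] at h1
    rw [Nat.cast_succ, ← add_assoc]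
    exact h1.resolve_right (hxy _ ih)

theorem fallingPow_eq_zero {x : ℂ → ℂ} (h : ∀ z, x z = 0) {n : ℕ} (hn : 1 ≤ n) (z : ℂ) :
    fallingPow x n z = 0 :=
  fallingPow_eq_zero_of_eq_zero (j := 0) hn (h _)

theorem eq_zero_of_fallingPow {x : ℂ → ℂ} (hx : Differentiable ℂ x) (hρ : growthOrder x < 1)
    {n : ℕ} (h : ∀ z, fallingPow x n z = 0) (z : ℂ) : x z = 0 := by
  by_contra hz
  obtain ⟨k, hk⟩ := exists_fallingPow_add_ne_zero hx hρ hz n 0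
  exact hk (h _)

/-- If one of the three functions vanishes identically, the other two are constant. -/
theorem isConstant_of_fallingPow_eq_or_neg {x y : ℂ → ℂ} (hx : Differentiable ℂ x)
    (hy : Differentiable ℂ y) (hρx : growthOrder x < 1) (hρy : growthOrder y < 1) {n : ℕ}
    (hn : 2 ≤ n) (h : RelativelyShiftingPrime (fallingPow x n) (fallingPow y n))
    {κ : ℂ} (hκ : κ ≠ 0) (hxy : ∀ z, fallingPow x n z = κ * fallingPow y n z) :
    IsConstant x ∧ IsConstant y := by
  by_cases hx0 : ∃ p, x p ≠ 0
  · by_cases hy0 : ∃ p, y p ≠ 0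
    · have hne := fun z => h.ne_zero_of_eq_zero hx hy hρx hρy hx0 hy0 hn (z := z)
      have hy' : ∀ z, fallingPow y n z ≠ 0 := fun z hz => hne z (by rw [hxy, hz, mul_zero]) hz
      exact ⟨isConstant_of_fallingPow_ne_zero (n := n) hx hρx (by omega) fun z => by
        rw [hxy]
        exact mul_ne_zero hκ (hy' z),
        isConstant_of_fallingPow_ne_zero (n := n) hy hρy (by omega) hy'⟩
    · push Not at hy0
      have hx' := eq_zero_of_fallingPow (n := n) hx hρx fun z => by
        rw [hxy, fallingPow_eq_zero hy0 (by omega), mul_zero]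
      exact ⟨⟨0, hx'⟩, ⟨0, hy0⟩⟩
  · push Not at hx0
    have hy' := eq_zero_of_fallingPow (n := n) hy hρy fun z => by
      have := hxy z
      rw [fallingPow_eq_zero hx0 (by omega), eq_comm, mul_eq_zero] at this
      exact this.resolve_left hκ
    exact ⟨⟨0, hx0⟩, ⟨0, hy'⟩⟩

end Fermat

end ShiftFermat

theorem theorem5p1 (a b c : ℂ → ℂ)
    (ha : ShiftFermat.IsEntire a) (hb : ShiftFermat.IsEntire b) (hc : ShiftFermat.IsEntire c)
    (hρa : ShiftFermat.growthOrder a < 1) (hρb : ShiftFermat.growthOrder b < 1)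
    (hρc : ShiftFermat.growthOrder c < 1)
    (hconst : ¬ (ShiftFermat.IsConstant a ∧ ShiftFermat.IsConstant b ∧ ShiftFermat.IsConstant c))
    (n : ℕ) (hn : 1 ≤ n)
    (hprime : ShiftFermat.RelativelyShiftingPrime₃
      (ShiftFermat.fallingPow a n) (ShiftFermat.fallingPow b n) (ShiftFermat.fallingPow c n))
    (hsum : ∀ z : ℂ, ShiftFermat.fallingPow a n z + ShiftFermat.fallingPow b n z
      = ShiftFermat.fallingPow c n z) :
    n ≤ 2 ∧
      ((ShiftFermat.IsConstant a ∨ ShiftFermat.IsConstant b ∨ ShiftFermat.IsConstant c) →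
        n = 1) := by
  open ShiftFermat in
  obtain ⟨hab, hac, hbc⟩ := hprime
  by_contra hcon
  obtain ⟨h2, h3⟩ : 2 ≤ n ∧ (3 ≤ n ∨ IsConstant a ∨ IsConstant b ∨ IsConstant c) := by
    by_cases h : IsConstant a ∨ IsConstant b ∨ IsConstant c
    · exact ⟨by by_contra h'; exact hcon ⟨by omega, fun _ => by omega⟩, Or.inr h⟩
    · have : 3 ≤ n := by
        by_contra h'
        exact hcon ⟨by omega, fun h'' => absurd h'' h⟩
      exact ⟨by omega, Or.inl this⟩
  -- Identically zero functions are treated apart: they have no zero of finite length, so primality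
  -- says nothing about them.
  by_cases ha0 : ∃ p, a p ≠ 0
  swap
  · push Not at ha0
    refine hconst ⟨⟨0, ha0⟩, isConstant_of_fallingPow_eq_or_neg hb hc hρb hρc h2 hbc one_ne_zero
      fun z => ?_⟩
    rw [← hsum, fallingPow_eq_zero ha0 hn]
    ring
  by_cases hb0 : ∃ p, b p ≠ 0
  swap
  · push Not at hb0
    obtain ⟨h1, h2⟩ := isConstant_of_fallingPow_eq_or_neg ha hc hρa hρc h2 hac one_ne_zero
      fun z => by
        rw [← hsum, fallingPow_eq_zero hb0 hn]
        ring
    exact hconst ⟨h1, ⟨0, hb0⟩, h2⟩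
  by_cases hc0 : ∃ p, c p ≠ 0
  swap
  · push Not at hc0
    obtain ⟨h1, h2⟩ := isConstant_of_fallingPow_eq_or_neg ha hb hρa hρb h2 hab
      (neg_ne_zero.2 one_ne_zero) fun z => by
        have := hsum z
        rw [fallingPow_eq_zero hc0 hn] at this
        linear_combination this
    exact hconst ⟨h1, h2, ⟨0, hc0⟩⟩
  have nab := fun z => hab.ne_zero_of_eq_zero ha hb hρa hρb ha0 hb0 h2 (z := z)
  have nac := fun z => hac.ne_zero_of_eq_zero ha hc hρa hρc ha0 hc0 h2 (z := z)
  have nbc := fun z => hbc.ne_zero_of_eq_zero hb hc hρb hρc hb0 hc0 h2 (z := z)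
  obtain ⟨m, rfl⟩ := Nat.exists_eq_add_of_le' hn
  -- The full Casorati determinant of the falling powers is A B w_ab. By the equation, its vanishing
  -- passes to the pairs (b, a) and (c, a).
  have hW : ∀ z, fallingPow a (m + 1) z * fallingPow b (m + 1) (z + 1) =
      fallingPow a (m + 1) (z + 1) * fallingPow b (m + 1) z := by
    intro z
    have := casorati_eq_zero ha hb hc hρa hρb hρc ha0 hb0 hc0 (m := m) (by omega)
      (h3.imp_left fun h => by omega) hsum (fun z hB hC => nbc z
        (by rw [fallingPow_succ, hB, zero_mul]) (by rw [fallingPow_succ, hC, zero_mul])) z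
    unfold casorati at this
    simp only [fallingPow_succ_add_one]
    simp only [fallingPow_succ]
    linear_combination fallingPow a m z * fallingPow b m z * this
  refine hconst ⟨isConstant_of_proportional ha hρa ha0 hn nab hW,
    isConstant_of_proportional hb hρb hb0 hn (fun z h h' => nab z h' h) fun z => ?_,
    isConstant_of_proportional hc hρc hc0 hn (fun z h h' => nac z h' h) fun z => ?_⟩
  · linear_combination -hW z
  · rw [← hsum, ← hsum]
    linear_combination -hW z
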